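/- Let $\Gamma$ be a torsion-free word hyperbolic group and let $T$ be a finite generating set of $\Gamma$. For $\gamma\in\Gamma$ let $\|\gamma\|=\min_{x\in\Gamma} d_T(x,\gamma x)$ be the translation length of $\gamma$ on $\Gamma$ with its word metric $d_T$ (equivalently, the minimal $T$-word length of a conjugate of $\gamma$). For $\phi\in\mathrm{Out}(\Gamma)$ and $\beta\in\Gamma$ let $\|\phi(\beta)\|=\|\bar\phi(\beta)\|$, where $\bar\phi\in\mathrm{Aut}(\Gamma)$ is any representative of $\phi$. Say that $\mathcal B\subset\Gamma$ is *sufficient* if for every $K\in\mathbb R$ the set $$\{\phi\in\mathrm{Out}(\Gamma)\ :\ \|\phi(\beta)\|\le K\ \text{ for all }\beta\in\mathcal B\}$$ is finite. Then: 1. There is a finite sufficient set $\mathcal B\subset\Gamma$. 2. More precisely, for every finite generating set $S$ of $\Gamma$ there is an integer $n>0$ such that $$\mathcal B=\{s^n : s\in S\}\cup\{s^nt^n : s,t\in S,\ s\ne t\}$$ is sufficient. 3. Suppose that $\Gamma$ admits a convex cocompact action on the symmetric space associated to a rank one Lie group; that is, there is a connected semisimple Lie group $G$ with trivial center, without compact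 factors and of real rank one, a maximal compact subgroup $K_0\subset G$ with symmetric space $X=G/K_0$, and a discrete, faithful representation $\rho:\Gamma\to G$ such that $N_\rho=X/\rho(\Gamma)$ contains a compact convex subset (one that contains every geodesic arc of $N_\rho$ with both endpoints in it) whose inclusion into $N_\rho$ is a homotopy equivalence. Then for every finite generating set $S$ of $\Gamma$ the set $$\mathcal B=S\cup\{st : s,t\in S\}$$ is sufficient. -/

import Mathlib

open scoped Manifold ContDiff Pointwise

noncomputable section

/-! ### Word metrics, hyperbolic groups, conjugacy length -/

section WordMetric

variable {Γ : Type*} [Group Γ]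

/-- `S` is a finite generating set of the group `Γ`. -/
def IsFiniteGenSet (S : Set Γ) : Prop :=
  S.Finite ∧ Subgroup.closure S = ⊤

/-- The word length of `g` with respect to `S`: the least length of a word in the letters
`S ∪ S⁻¹` that represents `g`. -/
def wordLength (S : Set Γ) (g : Γ) : ℕ :=
  sInf {n : ℕ | ∃ l : List Γ, l.length = n ∧ (∀ x ∈ l, x ∈ S ∨ x⁻¹ ∈ S) ∧ l.prod = g}

/-- The left-invariant word metric, that is, the path metric of the Cayley graph restricted to
its vertex set. -/
def wordDist (S : Set Γ) (g h : Γ) : ℕ :=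
  wordLength S (g⁻¹ * h)

/-- The translation length `‖γ‖` of the left action of `γ` on `Γ` with its word metric. -/
def conjLength (S : Set Γ) (γ : Γ) : ℕ :=
  sInf (Set.range fun x : Γ => wordDist S x (γ * x))

lemma conjLength_conj (S : Set Γ) (g γ : Γ) :
    conjLength S (g * γ * g⁻¹) = conjLength S γ := by
  unfold conjLength wordDist
  congr 1
  ext n
  constructor
  · rintro ⟨x, rfl⟩
    exact ⟨g⁻¹ * x, by simp [mul_assoc]⟩
  · rintro ⟨x, rfl⟩
    exact ⟨g * x, by simp [mul_assoc]⟩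

variable (Γ) in
/-- Gromov's word hyperbolicity: `Γ` is finitely generated and a word metric of `Γ` satisfies
the four-point condition for some `δ`. -/
def IsWordHyperbolic : Prop :=
  ∃ S : Set Γ, IsFiniteGenSet S ∧ ∃ δ : ℝ, ∀ x y z w : Γ,
    (wordDist S x z : ℝ) + wordDist S y w ≤
      max ((wordDist S x y : ℝ) + wordDist S z w) ((wordDist S x w : ℝ) + wordDist S y z) + 2 * δ

variable (Γ) in
/-- The outer automorphism group `Out(Γ) = Aut(Γ) / Inn(Γ)` (as a set of cosets). -/
abbrev OutAut : Type _ := MulAut Γ ⧸ (MulAut.conj : Γ →* MulAut Γ).range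

/-- `‖φ(β)‖` for an outer automorphism `φ`. -/
def outConjLength (S : Set Γ) (φ : OutAut Γ) (β : Γ) : ℕ :=
  Quotient.liftOn' φ (fun f => conjLength S (f β)) (by
    intro f f' h
    obtain ⟨g, hg⟩ := QuotientGroup.leftRel_apply.mp h
    have hf : f' = f * MulAut.conj g := by rw [hg, mul_inv_cancel_left]
    subst hf
    simp [conjLength_conj])

/-- For every `K`, only finitely many outer automorphisms `φ` satisfy `‖φ(β)‖ ≤ K` for all
`β ∈ B`; here `‖·‖` is computed with the finite generating set `T`. -/
def BoundsOuterAutomorphisms (T B : Set Γ) : Prop :=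
  ∀ K : ℝ, {φ : OutAut Γ | ∀ β ∈ B, (outConjLength T φ β : ℝ) ≤ K}.Finite

end WordMetric

/-! ### Rank one Lie groups -/

/-- The real rank of a real semisimple Lie algebra: the largest dimension of an abelian
subalgebra all of whose elements are `ad`-diagonalizable over `ℝ`. -/
def lieRealRank (L : Type*) [LieRing L] [LieAlgebra ℝ L] : ℕ :=
  sSup {n : ℕ | ∃ a : LieSubalgebra ℝ L, IsLieAbelian a ∧
    (∀ x ∈ a, ⨆ μ : ℝ, Module.End.eigenspace (LieAlgebra.ad ℝ L x) μ = ⊤) ∧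
    Module.finrank ℝ a = n}

section LieGroups

instance instLieGroupMinSmoothness (d : ℕ) (G : Type*) [Group G] [TopologicalSpace G]
    [ChartedSpace (EuclideanSpace ℝ (Fin d)) G] [LieGroup (𝓡 d) ∞ G] :
    LieGroup (𝓡 d) (minSmoothness ℝ 3) G :=
  LieGroup.of_le (n := ∞) (by
    rw [minSmoothness_of_isRCLikeNormedField]
    exact ENat.LEInfty.out)

/-- The Lie group `G` (of dimension `d`) is a connected semisimple Lie group with trivial center,
without compact factors, and of rank one. -/
structure IsRankOneLieGroup (d : ℕ) (G : Type*) [Group G] [TopologicalSpace G]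
    [ChartedSpace (EuclideanSpace ℝ (Fin d)) G] [LieGroup (𝓡 d) ∞ G] : Prop where
  hausdorff : T2Space G
  connected : ConnectedSpace G
  semisimple : LieAlgebra.IsSemisimple ℝ (GroupLieAlgebra (𝓡 d) G)
  center_eq_bot : Subgroup.center G = ⊥
  no_compact_factor : ∀ N : Subgroup G, N.Normal → IsCompact (N : Set G) →
    IsConnected (N : Set G) → N = ⊥
  rank_one : lieRealRank (GroupLieAlgebra (𝓡 d) G) = 1

end LieGroups

/-! ### The symmetric space `X = G / K` and convex cocompact representations -/

section SymmetricSpace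

variable {Γ G : Type*} [Group Γ] [Group G] [TopologicalSpace G]

/-- `K` is a maximal compact subgroup of `G`. -/
def IsMaximalCompactSubgroup (K : Subgroup G) : Prop :=
  Maximal (fun H : Subgroup G => IsCompact (H : Set G)) K

/-- `θ` is the Cartan involution of `G` attached to the maximal compact subgroup `K`: a continuous
involutive automorphism with fixed point group `K`. -/
def IsCartanInvolution (K : Subgroup G) (θ : G ≃* G) : Prop :=
  Continuous θ ∧ (∀ g, θ (θ g) = g) ∧ ∀ g, θ g = g ↔ g ∈ K

/-- The (complete, constant speed, possibly constant) geodesics of the symmetric space `X = G / K`: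
the curves `t ↦ g · c(t) · K`, where `c` is a one-parameter subgroup of `G` which is inverted by the
Cartan involution (a one-parameter group of transvections along a geodesic through `K`). -/
def IsSymmGeodesic (K : Subgroup G) (γ : ℝ → G ⧸ K) : Prop :=
  ∃ θ : G ≃* G, IsCartanInvolution K θ ∧
    ∃ c : ℝ → G, Continuous c ∧ (∀ s t, c (s + t) = c s * c t) ∧ (∀ t, θ (c t) = (c t)⁻¹) ∧
      ∃ g : G, ∀ t, γ t = ((g * c t : G) : G ⧸ K)

/-- The locally symmetric space `N_ρ = X / ρ(Γ)`, with the quotient topology. -/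
abbrev LocSymmSpace (K : Subgroup G) (ρ : Γ →* G) : Type _ :=
  Quotient (MulAction.orbitRel ρ.range (G ⧸ K))

/-- `A ⊆ N_ρ` is convex: every geodesic arc of `N_ρ` (the image of a geodesic arc of `X`) with both
endpoints in `A` is contained in `A`. -/
def IsGeodesicallyConvex (K : Subgroup G) (ρ : Γ →* G) (A : Set (LocSymmSpace K ρ)) : Prop :=
  ∀ γ : ℝ → G ⧸ K, IsSymmGeodesic K γ → ∀ a b : ℝ, a ≤ b →
    (Quotient.mk _ (γ a) : LocSymmSpace K ρ) ∈ A →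
    (Quotient.mk _ (γ b) : LocSymmSpace K ρ) ∈ A →
    ∀ t ∈ Set.Icc a b, (Quotient.mk _ (γ t) : LocSymmSpace K ρ) ∈ A

/-- `ρ` is convex cocompact: it is discrete and faithful, and `N_ρ` contains a compact convex subset
whose inclusion into `N_ρ` is a homotopy equivalence. -/
structure IsConvexCocompact (K : Subgroup G) (ρ : Γ →* G) : Prop where
  discrete : DiscreteTopology ρ.range
  faithful : Function.Injective ρ
  exists_core : ∃ A : Set (LocSymmSpace K ρ), IsCompact A ∧ IsGeodesicallyConvex K ρ A ∧
    ∃ e : ContinuousMap.HomotopyEquiv A (LocSymmSpace K ρ), ∀ a : A, e a = a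

end SymmetricSpace

end

/-!
By Serre's lemma, a group acting on a tree has a global fixed point as soon as finitely many
generators and their pairwise products have fixed points. The idea carries over to a word
hyperbolic group `Γ` acting on itself. Let a family of elements have short conjugates, as well as
the products of its pairs, and let `L` be the largest displacement of a point `x` by the family. An
element `g` with a short conjugate that moves `x` far backtracks: `g⁻¹ • x` and `g • x` lie in the
same direction from `x`. The bounds on the products force the directions of all elements displacing
`x` by nearly `L` to agree, so stepping in this common direction lowers the maximal displacement as
long as `L` is large. Hence some point is moved a bounded distance by the whole family.

Apply this to the images of a finite generating set under a homomorphism `f` into `Γ`: after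
conjugation, `f` maps the generators into a fixed ball, for which there are only finitely many
possibilities. In particular the exponent `n = 1` suffices.
-/

section GromovHyperbolic

/-- The Gromov product `(u | v)ₓ`, with the base point as first argument. -/
noncomputable def gromovProduct {X : Type*} [PseudoMetricSpace X] (x u v : X) : ℝ :=
  (dist x u + dist x v - dist u v) / 2

/-- Gromov's four-point condition with constant `δ`, normalized as in `IsWordHyperbolic`. -/
def IsGromovHyperbolic (X : Type*) [PseudoMetricSpace X] (δ : ℝ) : Prop :=
  ∀ x y z w : X,
    dist x z + dist y w ≤ max (dist x y + dist z w) (dist x w + dist y z) + 2 * δ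

/-- Any two points are joined by a geodesic up to an additive error `c`. This covers both geodesic
spaces and vertex sets of graphs, where only distances up to rounding are realized. -/
def IsCoarselyGeodesic (X : Type*) [PseudoMetricSpace X] (c : ℝ) : Prop :=
  ∀ (x y : X) (r : ℝ), 0 ≤ r → r ≤ dist x y → ∃ m, dist x m ≤ r ∧ dist m y ≤ dist x y - r + c

variable {X : Type*} [PseudoMetricSpace X] {δ : ℝ}

lemma gromovProduct_comm (x u v : X) : gromovProduct x u v = gromovProduct x v u := by
  rw [gromovProduct, gromovProduct, dist_comm u v, add_comm (dist x u)]

lemma IsGromovHyperbolic.nonneg [Nonempty X] (h : IsGromovHyperbolic X δ) : 0 ≤ δ := by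
  inhabit X
  simpa using h default default default default

lemma IsGromovHyperbolic.le_gromovProduct_trans (h : IsGromovHyperbolic X δ) {x u v w : X} {a : ℝ}
    (huv : a ≤ gromovProduct x u v) (hvw : a ≤ gromovProduct x v w) :
    a - δ ≤ gromovProduct x u w := by
  have h₄ := h u v w x
  unfold gromovProduct at *
  rw [dist_comm x u, dist_comm x v, dist_comm x w] at *
  rcases le_max_iff.mp (sub_le_iff_le_add.mpr h₄) with h | h <;> linarith

lemma IsCoarselyGeodesic.nonneg [Nonempty X] {c : ℝ} (hX : IsCoarselyGeodesic X c) : 0 ≤ c := by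
  inhabit X
  obtain ⟨m, -, hm⟩ := hX default default 0 le_rfl dist_nonneg
  simpa using dist_nonneg.trans hm

lemma IsCoarselyGeodesic.exists_le_gromovProduct {c : ℝ} (hX : IsCoarselyGeodesic X c) {x y : X}
    {r : ℝ} (hr : 0 ≤ r) (hxy : r ≤ dist x y) :
    ∃ m, dist x m ≤ r ∧ r - c ≤ gromovProduct x m y := by
  obtain ⟨m, hxm, hmy⟩ := hX x y r hr hxy
  have := dist_triangle x m y
  exact ⟨m, hxm, by rw [gromovProduct]; linarith⟩

lemma dist_smul_le_two_mul_add {G : Type*} [SMul G X]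
    [IsIsometricSMul G X] (g : G) (x m : X) :
    dist m (g • m) ≤ 2 * dist x m + dist x (g • x) := by
  have := dist_triangle4 m x (g • x) (g • m)
  rw [dist_smul, dist_comm m x] at this
  linarith

variable {G : Type*} [Group G] [MulAction G X] [IsIsometricSMul G X]

lemma dist_inv_smul_left (g : G) (x y : X) : dist (g⁻¹ • x) y = dist x (g • y) := by
  rw [← dist_smul g, smul_inv_smul]

lemma dist_self_inv_smul (g : G) (x : X) : dist x (g⁻¹ • x) = dist x (g • x) := by
  rw [dist_comm, dist_inv_smul_left]

/-- The model case is that of a tree in which `g` fixes `y`: the paths from `x` to `g • x` and to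
`g⁻¹ • x` then both start along the path from `x` to `y`. -/
lemma IsGromovHyperbolic.le_gromovProduct_inv_smul_smul (h : IsGromovHyperbolic X δ) {g : G}
    {y : X} {K : ℝ} (hy : dist y (g • y) ≤ K) (x : X) :
    (dist x (g • x) - K) / 2 - δ ≤ gromovProduct x (g⁻¹ • x) (g • x) := by
  have h₄ := h x (g • x) (g • g • x) y
  have hgx : dist (g • g • x) y ≤ dist (g • x) y + dist y (g • y) := by
    refine (dist_triangle _ (g • y) _).trans_eq ?_
    rw [dist_smul, dist_comm (g • y)]
  have hx : dist x y ≤ dist (g • x) y + dist y (g • y) := by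
    rw [← dist_smul g x y]
    exact dist_triangle _ _ _
  rw [dist_smul] at h₄
  rw [gromovProduct, dist_inv_smul_left, dist_self_inv_smul]
  rcases le_max_iff.mp (sub_le_iff_le_add.mpr h₄) with h | h <;> linarith

lemma IsGromovHyperbolic.le_gromovProduct_of_mul (h : IsGromovHyperbolic X δ) {s t : G}
    {x y₁ y₂ y₃ : X} {K L r : ℝ} (hs : dist y₁ (s • y₁) ≤ K)
    (ht : dist y₂ (t • y₂) ≤ K) (hst : dist y₃ ((s * t) • y₃) ≤ K)
    (hsx : L - 2 * r ≤ dist x (s • x)) (htx : L - 2 * r ≤ dist x (t • x))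
    (hL : K + 4 * r + 6 * δ ≤ L) :
    r ≤ gromovProduct x (s⁻¹ • x) (t • x) := by
  -- Otherwise `s * t` moves `x` about as far as `s` and `t` together, so `(s * t) • x` lies in the
  -- direction of `s • x` and `(s * t)⁻¹ • x` in that of `t⁻¹ • x`. Since `s`, `t` and `s * t` all
  -- backtrack at `x`, the directions of `s⁻¹ • x`, `s • x`, `t⁻¹ • x` and `t • x` agree after all.
  by_contra! hlt
  have hK : 0 ≤ K := dist_nonneg.trans hs
  have hδ : 0 ≤ δ := have : Nonempty X := ⟨x⟩; h.nonneg
  have backtrack_s := h.le_gromovProduct_inv_smul_smul hs x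
  have backtrack_t := h.le_gromovProduct_inv_smul_smul ht x
  have backtrack_st := h.le_gromovProduct_inv_smul_smul hst x
  have far : dist x (s • x) + dist x (t • x) - 2 * r ≤ dist x ((s * t) • x) := by
    rw [gromovProduct, dist_self_inv_smul, dist_inv_smul_left, smul_smul] at hlt
    linarith
  have near_s : L - 3 * r - K / 2 - δ ≤ gromovProduct x (s • x) ((s * t) • x) := by
    rw [gromovProduct, mul_smul, dist_smul, ← mul_smul]
    linarith
  have near_t : L - 3 * r - K / 2 - δ ≤ gromovProduct x ((s * t)⁻¹ • x) (t⁻¹ • x) := by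
    rw [gromovProduct, dist_self_inv_smul, dist_self_inv_smul, mul_inv_rev, mul_smul t⁻¹,
      dist_smul, dist_comm _ x, dist_self_inv_smul]
    linarith
  have near_st : L - 3 * r - K / 2 - δ ≤ gromovProduct x ((s * t) • x) ((s * t)⁻¹ • x) := by
    rw [gromovProduct_comm]
    linarith
  have s_inv_t : r + 2 * δ ≤ gromovProduct x (s • x) (t⁻¹ • x) :=
    le_trans (by linarith)
      (h.le_gromovProduct_trans (h.le_gromovProduct_trans near_s near_st)
        ((sub_le_self _ hδ).trans near_t))
  have inv_s_inv_t : r + 2 * δ - δ ≤ gromovProduct x (s⁻¹ • x) (t⁻¹ • x) :=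
    h.le_gromovProduct_trans (v := s • x) (by linarith) s_inv_t
  have inv_s_t : r + δ - δ ≤ gromovProduct x (s⁻¹ • x) (t • x) :=
    h.le_gromovProduct_trans (v := t⁻¹ • x) (by linarith) (by linarith)
  linarith

lemma IsGromovHyperbolic.dist_smul_le_max (h : IsGromovHyperbolic X δ) (g : G) (x m : X) {a b : ℝ}
    (ha : a ≤ gromovProduct x m (g • x)) (hb : b ≤ gromovProduct x m (g⁻¹ • x)) :
    dist m (g • m) ≤ max (2 * dist x m - dist x (g • x))
      (2 * dist x m + dist x (g • x) - 2 * a - 2 * b) + 2 * δ := by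
  have h₄ := h m x (g • m) (g • x)
  rw [dist_smul, dist_comm m x] at h₄
  rw [gromovProduct] at ha hb
  rw [dist_comm m (g⁻¹ • x), dist_inv_smul_left, dist_self_inv_smul] at hb
  rw [← sub_le_iff_le_add, le_max_iff]
  rcases le_max_iff.mp (sub_le_iff_le_add.mpr h₄) with h | h
  · exact Or.inl (by linarith)
  · exact Or.inr (by linarith)

/-- The isometries in `F` that move `x` almost as far as `L` all move it, forwards and backwards,
in one direction, so that a step in this direction decreases their displacements. -/
lemma IsGromovHyperbolic.exists_forall_dist_smul_le_sub_one (h : IsGromovHyperbolic X δ) {c : ℝ}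
    (hX : IsCoarselyGeodesic X c) {F : Set G} {K L : ℝ}
    (hF : ∀ s ∈ F, ∃ y : X, dist y (s • y) ≤ K)
    (hFF : ∀ s ∈ F, ∀ t ∈ F, s ≠ t → ∃ y : X, dist y ((s * t) • y) ≤ K)
    (hL : K + 8 * c + 30 * δ + 4 ≤ L) {x : X} (hx : ∀ s ∈ F, dist x (s • x) ≤ L) :
    ∃ m : X, ∀ s ∈ F, dist m (s • m) ≤ L - 1 := by
  by_cases! hxL : ∀ s ∈ F, dist x (s • x) ≤ L - 1
  · exact ⟨x, hxL⟩
  obtain ⟨s, hs, hsx⟩ := hxL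
  have : Nonempty X := ⟨x⟩
  have hδ := h.nonneg
  have hc := hX.nonneg
  obtain ⟨ys, hys⟩ := hF s hs
  have hK : 0 ≤ K := dist_nonneg.trans hys
  set r : ℝ := 2 * c + 6 * δ + 1 / 2 with hr
  obtain ⟨m, hxm, hms⟩ := hX.exists_le_gromovProduct (x := x) (y := s • x) (r := r)
    (by linarith) (by linarith)
  have backtrack_s : r ≤ gromovProduct x (s⁻¹ • x) (s • x) :=
    le_trans (by linarith) (h.le_gromovProduct_inv_smul_smul hys x)
  refine ⟨m, fun t ht => ?_⟩
  by_cases! htx : dist x (t • x) ≤ L - 2 * r - 1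
  · have := dist_smul_le_two_mul_add t x m
    linarith
  obtain ⟨yt, hyt⟩ := hF t ht
  have backtrack_t : r ≤ gromovProduct x (t⁻¹ • x) (t • x) :=
    le_trans (by linarith) (h.le_gromovProduct_inv_smul_smul hyt x)
  have inv_s_t : r ≤ gromovProduct x (s⁻¹ • x) (t • x) := by
    rcases eq_or_ne s t with rfl | hne
    · exact backtrack_s
    · obtain ⟨yst, hyst⟩ := hFF s hs t ht hne
      have := h.le_gromovProduct_of_mul (x := x) (r := r + 1 / 2) (L := L) hys hyt hyst
        (by linarith) (by linarith) (by linarith)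
      linarith
  have s_t : r - δ ≤ gromovProduct x (s • x) (t • x) :=
    h.le_gromovProduct_trans (by rwa [gromovProduct_comm]) inv_s_t
  have m_t : r - c - δ - δ ≤ gromovProduct x m (t • x) :=
    h.le_gromovProduct_trans (v := s • x) (by linarith) (by linarith)
  have m_inv_t : r - c - δ - δ - δ ≤ gromovProduct x m (t⁻¹ • x) :=
    h.le_gromovProduct_trans m_t (by rw [gromovProduct_comm]; linarith)
  have := h.dist_smul_le_max t x m m_t m_inv_t
  rcases le_max_iff.mp (sub_le_iff_le_add.mpr this) with h | h <;> linarith [hx t ht]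

/-- A coarse version of Serre's lemma: a finitely generated group acting on a tree has a global
fixed point if its generators and their pairwise products have fixed points. -/
theorem IsGromovHyperbolic.exists_forall_dist_smul_le (h : IsGromovHyperbolic X δ) {c : ℝ}
    (hX : IsCoarselyGeodesic X c) {F : Set G} {K : ℝ}
    (hbdd : ∃ (x : X) (L : ℝ), ∀ s ∈ F, dist x (s • x) ≤ L)
    (hF : ∀ s ∈ F, ∃ y : X, dist y (s • y) ≤ K)
    (hFF : ∀ s ∈ F, ∀ t ∈ F, s ≠ t → ∃ y : X, dist y ((s * t) • y) ≤ K) :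
    ∃ x : X, ∀ s ∈ F, dist x (s • x) ≤ K + 8 * c + 30 * δ + 4 := by
  obtain ⟨x, L, hx⟩ := hbdd
  obtain ⟨n, hn⟩ := exists_nat_ge (L - (K + 8 * c + 30 * δ + 4))
  replace hx (s : G) (hs : s ∈ F) : dist x (s • x) ≤ K + 8 * c + 30 * δ + 4 + n :=
    (hx s hs).trans (by linarith)
  clear hn
  induction n generalizing x with
  | zero => exact ⟨x, by simpa using hx⟩
  | succ n ih =>
    obtain ⟨m, hm⟩ := h.exists_forall_dist_smul_le_sub_one hX hF hFF
      (by push_cast; linarith [n.cast_nonneg (α := ℝ)]) hx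
    exact ih m fun s hs => (hm s hs).trans_eq (by push_cast; ring)

end GromovHyperbolic

section WordMetric

variable {Γ : Type*} [Group Γ] {S : Set Γ}

lemma exists_list_length_eq_wordLength (hS : Subgroup.closure S = ⊤) (g : Γ) :
    ∃ l : List Γ, l.length = wordLength S g ∧ (∀ x ∈ l, x ∈ S ∨ x⁻¹ ∈ S) ∧ l.prod = g := by
  have hg : g ∈ (Subgroup.closure S).toSubmonoid := hS ▸ Subgroup.mem_top g
  rw [Subgroup.closure_toSubmonoid] at hg
  obtain ⟨l, hlS, hl⟩ := Submonoid.exists_list_of_mem_closure hg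
  exact Nat.sInf_mem (s := {n : ℕ | ∃ l : List Γ, l.length = n ∧
    (∀ x ∈ l, x ∈ S ∨ x⁻¹ ∈ S) ∧ l.prod = g}) ⟨l.length, l, rfl, hlS, hl⟩

lemma wordLength_prod_le {l : List Γ} (hl : ∀ x ∈ l, x ∈ S ∨ x⁻¹ ∈ S) :
    wordLength S l.prod ≤ l.length :=
  Nat.sInf_le ⟨l, rfl, hl, rfl⟩

lemma wordLength_one : wordLength S (1 : Γ) = 0 :=
  Nat.le_zero.mp (wordLength_prod_le (S := S) (List.forall_mem_nil _))

lemma wordLength_mul_le (hS : Subgroup.closure S = ⊤) (g h : Γ) :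
    wordLength S (g * h) ≤ wordLength S g + wordLength S h := by
  obtain ⟨l, hl, hlS, rfl⟩ := exists_list_length_eq_wordLength hS g
  obtain ⟨k, hk, hkS, rfl⟩ := exists_list_length_eq_wordLength hS h
  rw [← hl, ← hk, ← List.prod_append, ← List.length_append]
  exact wordLength_prod_le (List.forall_mem_append.mpr ⟨hlS, hkS⟩)

lemma wordLength_inv_le (hS : Subgroup.closure S = ⊤) (g : Γ) :
    wordLength S g⁻¹ ≤ wordLength S g := by
  obtain ⟨l, hl, hlS, rfl⟩ := exists_list_length_eq_wordLength hS g
  rw [← hl, List.prod_inv_reverse]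
  refine (wordLength_prod_le fun x hx => ?_).trans_eq (by simp)
  obtain ⟨y, hy, rfl⟩ : ∃ y ∈ l, y⁻¹ = x := by simpa using hx
  simpa [or_comm] using hlS y hy

/-- The word length as a group seminorm, so that Mathlib's theory of left-invariant metrics on
groups applies to the word metric. -/
noncomputable def wordSeminorm (hS : Subgroup.closure S = ⊤) : GroupSeminorm Γ where
  toFun g := wordLength S g
  map_one' := by exact_mod_cast wordLength_one
  mul_le' g h := by exact_mod_cast wordLength_mul_le hS g h
  inv' g := by
    exact_mod_cast (wordLength_inv_le hS g).antisymm (by simpa using wordLength_inv_le hS g⁻¹)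

/-- The group `Γ` with the word metric `wordDist S`, as a reducible non-instance because the metric
depends on `S`. -/
noncomputable abbrev wordSeminormedGroup (hS : Subgroup.closure S = ⊤) : SeminormedGroup Γ :=
  (wordSeminorm hS).toSeminormedGroup

lemma isCoarselyGeodesic_wordDist (hS : Subgroup.closure S = ⊤) :
    @IsCoarselyGeodesic Γ (wordSeminormedGroup hS).toPseudoMetricSpace 1 := by
  intro x y r hr hrxy
  obtain ⟨l, hl, hlS, hlxy⟩ := exists_list_length_eq_wordLength hS (x⁻¹ * y)
  have hle : ⌊r⌋₊ ≤ l.length := by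
    rw [hl]
    exact Nat.floor_le_of_le hrxy
  have hxm : wordDist S x (x * (l.take ⌊r⌋₊).prod) ≤ ⌊r⌋₊ := by
    rw [wordDist, inv_mul_cancel_left]
    exact (wordLength_prod_le fun z hz => hlS z (List.mem_of_mem_take hz)).trans
      (List.length_take_le _ _)
  have hmy : wordDist S (x * (l.take ⌊r⌋₊).prod) y ≤ wordDist S x y - ⌊r⌋₊ := by
    have hdrop : (x * (l.take ⌊r⌋₊).prod)⁻¹ * y = (l.drop ⌊r⌋₊).prod := by
      rw [mul_inv_rev, mul_assoc, ← hlxy, ← List.prod_take_mul_prod_drop l ⌊r⌋₊,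
        inv_mul_cancel_left]
    rw [wordDist, hdrop, wordDist, ← hl, ← List.length_drop]
    exact wordLength_prod_le fun z hz => hlS z (List.mem_of_mem_drop hz)
  refine ⟨x * (l.take ⌊r⌋₊).prod, (Nat.cast_le.mpr hxm).trans (Nat.floor_le hr), ?_⟩
  change (wordDist S _ y : ℝ) ≤ wordDist S x y - r + 1
  have : (wordDist S (x * (l.take ⌊r⌋₊).prod) y : ℝ) + ⌊r⌋₊ ≤ wordDist S x y := by
    exact_mod_cast Nat.add_le_of_le_sub (hle.trans_eq hl) hmy
  linarith [Nat.lt_floor_add_one r]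

lemma finite_setOf_wordLength_le (hS : IsFiniteGenSet S) (N : ℝ) :
    {g : Γ | (wordLength S g : ℝ) ≤ N}.Finite := by
  have : Finite {x : Γ | x ∈ S ∨ x⁻¹ ∈ S} := hS.1.union (hS.1.preimage inv_injective.injOn)
  refine ((List.finite_length_le {x : Γ | x ∈ S ∨ x⁻¹ ∈ S} ⌊N⌋₊).image
    fun l => (l.map Subtype.val).prod).subset fun g hg => ?_
  obtain ⟨l, hl, hlS, rfl⟩ := exists_list_length_eq_wordLength hS.2 g
  lift l to List {x : Γ | x ∈ S ∨ x⁻¹ ∈ S} using hlS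
  exact ⟨l, by simpa using hl.trans_le (Nat.le_floor hg), rfl⟩

lemma exists_forall_le_mul_wordLength (hS : IsFiniteGenSet S) (p : GroupSeminorm Γ) :
    ∃ M : ℝ, 0 ≤ M ∧ ∀ g, p g ≤ M * wordLength S g := by
  obtain ⟨M, hM⟩ := (hS.1.image p).bddAbove
  refine ⟨max M 0, le_max_right M 0, fun g => ?_⟩
  obtain ⟨l, hl, hlS, rfl⟩ := exists_list_length_eq_wordLength hS.2 g
  have hletter : ∀ x ∈ l, p x ≤ max M 0 := fun x hx =>
    le_max_of_le_left <| (hlS x hx).elim (fun h => hM ⟨x, h, rfl⟩)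
      fun h => map_inv_eq_map p x ▸ hM ⟨x⁻¹, h, rfl⟩
  calc p l.prod ≤ (l.map p).sum :=
        l.apply_prod_le_sum_map p (map_one_eq_zero p).le (map_mul_le_add p)
    _ ≤ (l.map p).length • max M 0 := List.sum_le_card_nsmul _ _ (by simpa using hletter)
    _ = max M 0 * wordLength S l.prod := by rw [List.length_map, hl, nsmul_eq_mul, mul_comm]

lemma exists_wordDist_eq_conjLength (S : Set Γ) (γ : Γ) :
    ∃ x, wordDist S x (γ * x) = conjLength S γ :=
  Nat.sInf_mem (Set.range_nonempty fun x : Γ => wordDist S x (γ * x))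

end WordMetric

section Homomorphisms

lemma finite_setOf_monoidHom {Λ M : Type*} [Group Λ] [Monoid M] {S : Set Λ}
    (hS : IsFiniteGenSet S) {B : Set M} (hB : B.Finite) :
    {f : Λ →* M | ∀ s ∈ S, f s ∈ B}.Finite := by
  have := hS.1.to_subtype
  refine Set.Finite.of_finite_image (f := fun f (s : S) => f s)
    ((Set.Finite.pi' fun _ => hB).subset ?_) fun f _ f' _ hff' => ?_
  · rintro _ ⟨f, hf, rfl⟩ s
    exact hf s s.2
  · exact MonoidHom.eq_of_eqOn_dense hS.2 fun s hs => congrFun hff' ⟨s, hs⟩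

variable {Γ : Type*} [Group Γ]

theorem IsWordHyperbolic.exists_finite_forall_conj_comp_mem (hyp : IsWordHyperbolic Γ)
    {T : Set Γ} (hT : IsFiniteGenSet T) {Λ : Type*} [Group Λ] {S : Set Λ} (hS : IsFiniteGenSet S)
    (K : ℝ) :
    ∃ H : Set (Λ →* Γ), H.Finite ∧ ∀ f : Λ →* Γ, (∀ s ∈ S, conjLength T (f s) ≤ K) →
      (∀ s ∈ S, ∀ t ∈ S, s ≠ t → conjLength T (f (s * t)) ≤ K) →
      ∃ x : Γ, (MulAut.conj x).toMonoidHom.comp f ∈ H := by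
  obtain ⟨U, hU, δ, hδ⟩ := hyp
  let := wordSeminormedGroup hU.2
  obtain ⟨M, hM₀, hM⟩ := exists_forall_le_mul_wordLength hT (wordSeminorm hU.2)
  have short {g : Γ} (hg : conjLength T g ≤ K) : ∃ y : Γ, dist y (g • y) ≤ M * K := by
    obtain ⟨y, hy⟩ := exists_wordDist_eq_conjLength T g
    refine ⟨y, (hM _).trans (mul_le_mul_of_nonneg_left ?_ hM₀)⟩
    rwa [← hy] at hg
  refine ⟨_, finite_setOf_monoidHom hS
    (finite_setOf_wordLength_le hU (M * K + 8 * 1 + 30 * δ + 4)), fun f hf₁ hf₂ => ?_⟩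
  obtain ⟨L, hL⟩ := (hS.1.image fun s => dist 1 (f s • 1 : Γ)).bddAbove
  obtain ⟨x, hx⟩ := IsGromovHyperbolic.exists_forall_dist_smul_le (F := f '' S) (K := M * K) hδ
    (isCoarselyGeodesic_wordDist hU.2)
    ⟨1, L, Set.forall_mem_image.mpr fun s hs => hL ⟨s, hs, rfl⟩⟩
    (Set.forall_mem_image.mpr fun s hs => short (hf₁ s hs))
    (Set.forall_mem_image.mpr fun s hs => Set.forall_mem_image.mpr fun t ht hne =>
      map_mul f s t ▸ short (hf₂ s hs t ht (ne_of_apply_ne f hne)))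
  refine ⟨x⁻¹, fun s hs => ?_⟩
  have := hx (f s) ⟨s, hs, rfl⟩
  change (wordLength U (x⁻¹ * (f s * x)) : ℝ) ≤ _ at this
  simpa [mul_assoc] using this

lemma OutAut.mk_conj_mul (g : Γ) (f : MulAut Γ) :
    ((MulAut.conj g * f : MulAut Γ) : OutAut Γ) = f := by
  refine (QuotientGroup.eq.mpr (MonoidHom.mem_range.mpr ⟨f⁻¹ g, ?_⟩)).symm
  ext x
  simp [MulAut.mul_apply]

lemma BoundsOuterAutomorphisms.mono {T B C : Set Γ} (hB : BoundsOuterAutomorphisms T B)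
    (hBC : B ⊆ C) : BoundsOuterAutomorphisms T C :=
  fun K => (hB K).subset fun _ hφ β hβ => hφ β (hBC hβ)

theorem mainTheorem1_general (hyp : IsWordHyperbolic Γ) {T S : Set Γ} (hT : IsFiniteGenSet T)
    (hS : IsFiniteGenSet S) :
    BoundsOuterAutomorphisms T (S ∪ {β | ∃ s ∈ S, ∃ t ∈ S, s ≠ t ∧ β = s * t}) := by
  intro K
  obtain ⟨H, hH, hmem⟩ := hyp.exists_finite_forall_conj_comp_mem hT hS K
  refine ((hH.preimage MulEquiv.toMonoidHom_injective.injOn).image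
    (QuotientGroup.mk : MulAut Γ → OutAut Γ)).subset fun φ hφ => ?_
  induction φ using QuotientGroup.induction_on with | H f => ?_
  obtain ⟨x, hx⟩ := hmem f.toMonoidHom (fun s hs => hφ s (.inl hs))
    fun s hs t ht hne => hφ (s * t) (.inr ⟨s, hs, t, ht, hne, rfl⟩)
  exact ⟨MulAut.conj x * f, hx, OutAut.mk_conj_mul x f⟩

end Homomorphisms

theorem mainTheorem1 {Γ : Type*} [Group Γ]
    (hyp : IsWordHyperbolic Γ) (torsionFree : ∀ g : Γ, IsOfFinOrder g → g = 1)
    (T : Set Γ) (hT : IsFiniteGenSet T) :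
    (∃ B : Set Γ, B.Finite ∧ BoundsOuterAutomorphisms T B) ∧
    (∀ S : Set Γ, IsFiniteGenSet S → ∃ n : ℕ, 0 < n ∧
      BoundsOuterAutomorphisms T
        ({β | ∃ s ∈ S, β = s ^ n} ∪ {β | ∃ s ∈ S, ∃ t ∈ S, s ≠ t ∧ β = s ^ n * t ^ n})) ∧
    (∀ (d : ℕ) (G : Type*) [Group G] [TopologicalSpace G]
      [ChartedSpace (EuclideanSpace ℝ (Fin d)) G] [LieGroup (𝓡 d) ∞ G]
      (_ : IsRankOneLieGroup d G) (K : Subgroup G) (_ : IsMaximalCompactSubgroup K)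
      (ρ : Γ →* G) (_ : IsConvexCocompact K ρ),
      ∀ S : Set Γ, IsFiniteGenSet S → BoundsOuterAutomorphisms T (S ∪ S * S)) := by
  have pairs_subset (S : Set Γ) : {β | ∃ s ∈ S, ∃ t ∈ S, s ≠ t ∧ β = s * t} ⊆ S * S := by
    rintro _ ⟨s, hs, t, ht, -, rfl⟩
    exact Set.mul_mem_mul hs ht
  have ⟨U, hU, _⟩ := hyp
  exact ⟨⟨_, hU.1.union ((hU.1.mul hU.1).subset (pairs_subset U)), mainTheorem1_general hyp hT hU⟩,
    fun S hS => ⟨1, one_pos, by simpa using mainTheorem1_general hyp hT hS⟩,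
    fun _ _ _ _ _ _ _ _ _ _ _ S hS =>
      (mainTheorem1_general hyp hT hS).mono (Set.union_subset_union_right S (pairs_subset S))⟩
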